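/- Let $\mathbb K$ be a field of characteristic zero, $G$ an abelian group (written multiplicatively, with identity $e$), and $\varepsilon\colon G\times G\to\mathbb K^\times$ an antisymmetric bicharacter, i.e. $\varepsilon(g,h)\varepsilon(h,g)=1$, $\varepsilon(g,hk)=\varepsilon(g,h)\varepsilon(g,k)$ and $\varepsilon(gh,k)=\varepsilon(g,k)\varepsilon(h,k)$ for all $g,h,k\in G$. Write $|a|$ for the degree of a homogeneous element $a$ of a $G$-graded space. Let $L=\bigoplus_{g\in G}L_g$ be a $G$-graded $\varepsilon$-Lie algebra (color Lie algebra) over $\mathbb K$, i.e. a $G$-graded vector space with a bilinear bracket such that $[L_g,L_h]\subseteq L_{gh}$ for all $g,h\in G$ and, for all homogeneous $a,b,c\in L$, $$[a,b]=-\varepsilon(|a|,|b|)[b,a],$$ $$\varepsilon(|c|,|a|)[a,[b,c]]+\varepsilon(|a|,|b|)[b,[c,a]]+\varepsilon(|b|,|c|)[c,[a,b]]=0.$$ Let $\omega$ be a scalar graded $2$-cocycle of degree zero on $L$, i.e. a bilinear form $\omega\colon L\times L\to\mathbb K$ such that, for all homogeneous $x,y,z\in L$, $\omega(x,y)=0$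 unless $|x||y|=e$, $\omega(x,y)=-\varepsilon(|x|,|y|)\,\omega(y,x)$, and $$\varepsilon(|z|,|x|)\,\omega(x,[y,z])+\varepsilon(|x|,|y|)\,\omega(y,[z,x])+\varepsilon(|y|,|z|)\,\omega(z,[x,y])=0.$$ Let $U_\omega(L)$ be the quotient of the tensor algebra $T(L)$ by the two-sided ideal generated by the elements $v_1\otimes v_2-\varepsilon(|v_1|,|v_2|)\,v_2\otimes v_1-[v_1,v_2]-\omega(v_1,v_2)$ with $v_1,v_2\in L$ homogeneous, and let $i_\omega\colon L\to U_\omega(L)$ be the canonical linear map. Let $\{x_i\}_{i\in I}$ be a basis of $L$ consisting of homogeneous elements, $x_i\in L_{g_i}$, where $I$ is a well-ordered set, and put $z_i=i_\omega(x_i)$. Then the ordered monomials $$z_{i_1}\cdots z_{i_n},\qquad n\ge 0,\quad i_j\le i_{j+1}\ \text{ for } 1\le j<n,\quad i_j<i_{j+1}\ \text{ whenever } \varepsilon(g_{i_j},g_{i_j})\ne 1,$$ (the empty monomial, $n=0$, being $1$) form a $\mathbb K$-basis of $U_\omega(L)$, distinct index sequences giving distinct basis elements. As a corollary, $i_\omega$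 is injective, and it satisfies $i_\omega(a)\,i_\omega(b)-\varepsilon(|a|,|b|)\,i_\omega(b)\,i_\omega(a)=i_\omega([a,b])+\omega(a,b)\cdot 1$ for all homogeneous $a,b\in L$. -/

import Mathlib

namespace ColorLie

universe u v w

/-- An antisymmetric bicharacter `ε : G × G → 𝕂ˣ` on an abelian group `G`. -/
structure IsAntisymmBicharacter {𝕂 : Type u} [Field 𝕂] {G : Type v} [CommGroup G]
    (ε : G → G → 𝕂ˣ) : Prop where
  antisymm : ∀ g h, ε g h * ε h g = 1
  map_mul_right : ∀ g h k, ε g (h * k) = ε g h * ε g k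
  map_mul_left : ∀ g h k, ε (g * h) k = ε g k * ε h k

/-- The structure of a `G`-graded `ε`-Lie algebra (color Lie algebra) on the vector space `L`. -/
structure ColorLieAlgebra {𝕂 : Type u} [Field 𝕂] {G : Type v} [CommGroup G] [DecidableEq G]
    (ε : G → G → 𝕂ˣ) (L : Type w) [AddCommGroup L] [Module 𝕂 L] where
  /-- the homogeneous components `L_g` -/
  grading : G → Submodule 𝕂 L
  /-- the bilinear bracket -/
  bracket : L →ₗ[𝕂] L →ₗ[𝕂] L
  isInternal : DirectSum.IsInternal grading
  bracket_mem : ∀ g h a b, a ∈ grading g → b ∈ grading h → bracket a b ∈ grading (g * h)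
  bracket_skew : ∀ g h a b, a ∈ grading g → b ∈ grading h →
    bracket a b = -((ε g h : 𝕂) • bracket b a)
  jacobi : ∀ g h k a b c, a ∈ grading g → b ∈ grading h → c ∈ grading k →
    (ε k g : 𝕂) • bracket a (bracket b c) + (ε g h : 𝕂) • bracket b (bracket c a)
      + (ε h k : 𝕂) • bracket c (bracket a b) = 0

variable {𝕂 : Type u} [Field 𝕂] {G : Type v} [CommGroup G] [DecidableEq G]
  {ε : G → G → 𝕂ˣ} {L : Type w} [AddCommGroup L] [Module 𝕂 L]

/-- Scalar graded 2-cocycles of degree zero: `ε`-skew-symmetric bilinear forms on `L`, homogeneous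
of degree zero (`𝕂` is concentrated in degree `1`), which satisfy the cocycle identity with values
in the trivial module `𝕂`. -/
structure IsGradedTwoCocycle (A : ColorLieAlgebra ε L) (ω : L →ₗ[𝕂] L →ₗ[𝕂] 𝕂) : Prop where
  degree_zero : ∀ g h x y, x ∈ A.grading g → y ∈ A.grading h → g * h ≠ 1 → ω x y = 0
  skew : ∀ g h x y, x ∈ A.grading g → y ∈ A.grading h → ω x y = -((ε g h : 𝕂) * ω y x)
  cocycle : ∀ g h k x y z, x ∈ A.grading g → y ∈ A.grading h → z ∈ A.grading k →
    (ε k g : 𝕂) * ω x (A.bracket y z) + (ε g h : 𝕂) * ω y (A.bracket z x)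
      + (ε h k : 𝕂) * ω z (A.bracket x y) = 0

/-- The relation on the tensor algebra that sets to zero the elements
`v₁ ⊗ v₂ - ε(|v₁|,|v₂|) v₂ ⊗ v₁ - [v₁,v₂] - ω(v₁,v₂)` for homogeneous `v₁`, `v₂`. -/
inductive GenEnvRel (A : ColorLieAlgebra ε L) (ω : L →ₗ[𝕂] L →ₗ[𝕂] 𝕂) :
    TensorAlgebra 𝕂 L → TensorAlgebra 𝕂 L → Prop
  | rel (g h : G) (v₁ v₂ : L) (h₁ : v₁ ∈ A.grading g) (h₂ : v₂ ∈ A.grading h) :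
      GenEnvRel A ω
        (TensorAlgebra.ι 𝕂 v₁ * TensorAlgebra.ι 𝕂 v₂
          - (ε g h : 𝕂) • (TensorAlgebra.ι 𝕂 v₂ * TensorAlgebra.ι 𝕂 v₁)
          - TensorAlgebra.ι 𝕂 (A.bracket v₁ v₂)
          - algebraMap 𝕂 (TensorAlgebra 𝕂 L) (ω v₁ v₂)) 0

/-- The generalized enveloping algebra `U_ω(L)`: the quotient of the tensor algebra of `L` by the
two-sided ideal generated by the above elements. -/
abbrev GenEnv (A : ColorLieAlgebra ε L) (ω : L →ₗ[𝕂] L →ₗ[𝕂] 𝕂) : Type (max u w) :=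
  RingQuot (GenEnvRel A ω)

/-- The canonical map `i_ω : L → U_ω(L)`. -/
noncomputable def GenEnv.ι (A : ColorLieAlgebra ε L) (ω : L →ₗ[𝕂] L →ₗ[𝕂] 𝕂) :
    L →ₗ[𝕂] GenEnv A ω :=
  (RingQuot.mkAlgHom 𝕂 (GenEnvRel A ω)).toLinearMap ∘ₗ TensorAlgebra.ι 𝕂

/-- For basis vectors with index set `I` and degrees `d i`: a finite sequence `i₁, …, i_n` of
indices (possibly empty) is ordered if `i_j ≤ i_{j+1}` for all `j`, with strict inequality
whenever `ε(d i_j, d i_j) ≠ 1`. -/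
def IsOrderedSeq {I : Type*} [LinearOrder I] (ε : G → G → 𝕂ˣ) (d : I → G) (l : List I) : Prop :=
  l.IsChain fun i j => i ≤ j ∧ (ε (d i) (d i) ≠ 1 → i < j)

end ColorLie

/-!
The proof is Bergman's diamond lemma for the words in the basis vectors `x i`, inside the tensor
algebra. Call a pair `(i, j)` an inversion if `j < i`, or if `i = j` and `ε(d i, d i) ≠ 1`, so
that a word is ordered exactly when no two neighbours form an inversion. The defining relators of
`U_ω(L)` rewrite a word with an inversion into words that are smaller in the shortlex order, which
is well-founded because `I` is well-ordered (`exists_reduction`; when `i = j` the relator reads `2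
x_i x_i - [x_i, x_i] - ω(x_i, x_i)` and one divides by `2`). Hence the ordered words span, and
choosing one inversion in each unordered word defines, by well-founded recursion, a linear map `σ`
from the tensor algebra to the free module on words that fixes the ordered words.

The point is that `σ` vanishes on the whole ideal, that is, that the chosen inversion does not
matter. By induction along the shortlex order only two inversions in the same word have to be
compared. If they are disjoint, the two relators can be applied independently
(`KillsBelow.disjoint`). If they share a letter, `KillsBelow.overlap` compares them by the
identity `relator_hexagon`: the alternating sum, weighted by values of `ε`, of the six ways to
place a relator on two of three letters `u, v, w` is a combination of relators of a letter and a
bracket, which belong to shorter words. This identity is where the Jacobi and cocycle identities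
enter, as well as the fact that `ω` has degree zero, which makes the scalars `ω(u, v)` commute
past `w` without a sign. In characteristic zero the degenerate cases `i = j` and `j = k` need only
a division by `2`, and `i = j = k` a division by `3`.

Since `σ` factors through `U_ω(L)` (`map_eq_of_mkAlgHom_eq`) and sends distinct ordered words to
distinct basis vectors, the ordered monomials are linearly independent.
-/

namespace ColorLie

variable {𝕂 : Type*} [Field 𝕂] {G : Type*} {ε : G → G → 𝕂ˣ}
  {L : Type*} [AddCommGroup L] [Module 𝕂 L] {I : Type*}

/-! ### Linear maps defined by well-founded reduction, and maps out of quotients -/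

/-- If each basis vector `B w` is assigned a combination `τ w` of smaller basis vectors, then there
is a linear map `σ` with arbitrarily prescribed differences `σ (B w) - σ (τ w)`. -/
theorem exists_linearMap_of_reduction {W T S : Type*} [AddCommGroup T] [Module 𝕂 T]
    [AddCommGroup S] [Module 𝕂 S] (B : Module.Basis W 𝕂 T) {r : W → W → Prop}
    (hr : WellFounded r) (s : W → S) (τ : W → T)
    (hτ : ∀ w, τ w ∈ Submodule.span 𝕂 (B '' {v | r v w})) :
    ∃ σ : T →ₗ[𝕂] S, ∀ w, σ (B w) = s w + σ (τ w) := by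
  classical
  let F : ∀ w, (∀ v, r v w → S) → S := fun w ih =>
    s w + ∑ v ∈ (B.repr (τ w)).support, if h : r v w then B.repr (τ w) v • ih v h else 0
  refine ⟨B.constr 𝕂 (hr.fix F), fun w => ?_⟩
  rw [Module.Basis.constr_basis, hr.fix_eq, Module.Basis.constr_apply, Finsupp.sum]
  refine congrArg (s w + ·) (Finset.sum_congr rfl fun v hv => ?_)
  exact dif_pos (B.mem_span_image.1 (hτ w) hv)

/-- A linear map `σ` with `σ (p * s * q) = σ (p * t * q)` for all related `s`, `t` and all `p`, `q`
factors through the quotient by the two-sided ideal generated by the relation. -/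
theorem map_eq_of_mkAlgHom_eq {T S : Type*} [Ring T] [Algebra 𝕂 T] [AddCommGroup S]
    [Module 𝕂 S] {r : T → T → Prop} (σ : T →ₗ[𝕂] S)
    (hσ : ∀ s t, r s t → ∀ p q, σ (p * s * q) = σ (p * t * q)) {s t : T}
    (h : RingQuot.mkAlgHom 𝕂 r s = RingQuot.mkAlgHom 𝕂 r t) : σ s = σ t := by
  have key : ∀ s t, RingQuot.Rel r s t → ∀ p q, σ (p * s * q) = σ (p * t * q) := by
    intro s t hst
    induction hst with
    | of h => exact hσ _ _ h
    | add_left _ ih => intro p q; simp only [mul_add, add_mul, map_add, ih]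
    | mul_left _ ih => intro p q; simpa only [mul_assoc] using ih p (_ * q)
    | mul_right _ ih => intro p q; simpa only [mul_assoc] using ih (p * _) q
  have h' : RingQuot.mkRingHom r s = RingQuot.mkRingHom r t := by
    rw [← RingQuot.mkAlgHom_coe 𝕂]; exact h
  have h2 : Relation.EqvGen (RingQuot.Rel r) s t := by
    simp only [RingQuot.mkRingHom_def] at h'
    exact Quot.eqvGen_exact (congrArg RingQuot.toQuot h')
  clear h h'
  induction h2 with
  | rel s t h => simpa using key s t h 1 1
  | refl => rfl
  | symm _ _ _ ih => exact ih.symm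
  | trans _ _ _ _ _ ih₁ ih₂ => exact ih₁.trans ih₂

/-! ### Inversions and the shortlex order -/

section
variable [LinearOrder I]

/-- Neighbours `i, j` in a word that violate the ordering condition of `IsOrderedSeq`. -/
def IsInversion (ε : G → G → 𝕂ˣ) (d : I → G) (i j : I) : Prop :=
  j < i ∨ (i = j ∧ ε (d i) (d i) ≠ 1)

theorem isOrderedSeq_iff {l : List I} : IsOrderedSeq ε d l ↔
    ∀ a i j b, l = a ++ i :: j :: b → ¬ IsInversion ε d i j := by
  rw [IsOrderedSeq, List.isChain_iff_forall_rel_of_append_cons_cons]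
  have h : ∀ i j, (i ≤ j ∧ (ε (d i) (d i) ≠ 1 → i < j)) ↔ ¬ IsInversion ε d i j := by
    intro i j
    rw [IsInversion, not_or, not_lt, not_and]
    refine and_congr_right fun hij => ⟨fun h e he => (h he).ne e, fun h he => ?_⟩
    exact lt_of_le_of_ne hij fun e => h e he
  simp only [h]
  constructor
  · intro H a i j b e; exact H e
  · intro H a b c e f; exact H _ _ _ _ f

theorem shortlex_append_cons {i j : I} (h : j < i) (a : List I) {s t : List I}
    (hst : s.length = t.length) : List.Shortlex (· < ·) (a ++ j :: s) (a ++ i :: t) :=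
  .append_left (.of_lex (by simp [hst]) (.rel h)) a

end

variable [CommGroup G]

/-! ### Bicharacters -/

theorem IsAntisymmBicharacter.coe_mul_coe_swap (hε : IsAntisymmBicharacter ε) (g h : G) :
    (ε g h : 𝕂) * ε h g = 1 := by
  rw [← Units.val_mul, hε.antisymm, Units.val_one]

theorem IsAntisymmBicharacter.coe_map_mul_right (hε : IsAntisymmBicharacter ε) (g h k : G) :
    (ε g (h * k) : 𝕂) = ε g h * ε g k := by
  rw [hε.map_mul_right, Units.val_mul]

theorem IsAntisymmBicharacter.coe_map_mul_left (hε : IsAntisymmBicharacter ε) (g h k : G) :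
    (ε (g * h) k : 𝕂) = ε g k * ε h k := by
  rw [hε.map_mul_left, Units.val_mul]

theorem IsAntisymmBicharacter.self_eq_neg_one (hε : IsAntisymmBicharacter ε) {g : G}
    (hg : ε g g ≠ 1) : (ε g g : 𝕂) = -1 :=
  (mul_self_eq_one_iff.1 (hε.coe_mul_coe_swap g g)).resolve_left (by simpa using hg)

variable [DecidableEq G]

/-! ### Homogeneous elements and words -/

variable {A : ColorLieAlgebra ε L} {ω : L →ₗ[𝕂] L →ₗ[𝕂] 𝕂} {x : Module.Basis I 𝕂 L} {d : I → G}

/-- Only basis vectors of degree `g` occur in the expansion of an element of degree `g`. -/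
theorem degree_eq_of_repr_ne_zero (A : ColorLieAlgebra ε L) {x : Module.Basis I 𝕂 L} {d : I → G}
    (hx : ∀ i, x i ∈ A.grading (d i)) {g : G} {u : L} (hu : u ∈ A.grading g) {i : I}
    (hi : x.repr u i ≠ 0) : d i = g := by
  classical
  by_contra hne
  set p := (x.repr u).filter (fun m => d m = g)
  set q := (x.repr u).filter (fun m => ¬ d m = g) with hq
  have hpq : p + q = x.repr u := Finsupp.filter_add_filter_not _ _
  have hsum : Finsupp.linearCombination 𝕂 x p + Finsupp.linearCombination 𝕂 x q = u := by
    rw [← map_add, hpq, x.linearCombination_repr]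
  have hp : Finsupp.linearCombination 𝕂 x p ∈ A.grading g := by
    refine Submodule.sum_mem _ fun m hm => Submodule.smul_mem _ _ ?_
    have := (Finsupp.mem_support_iff.1 hm)
    have h2 : d m = g := by
      by_contra h
      exact this (Finsupp.filter_apply_neg _ _ h)
    exact h2 ▸ hx m
  have hq' : Finsupp.linearCombination 𝕂 x q ∈ ⨆ h, ⨆ (_ : h ≠ g), A.grading h := by
    refine Submodule.sum_mem _ fun m hm => Submodule.smul_mem _ _ ?_
    have := (Finsupp.mem_support_iff.1 hm)
    have h2 : d m ≠ g := by
      intro h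
      exact this (Finsupp.filter_apply_neg _ _ (not_not.2 h))
    exact (le_iSup₂_of_le (f := fun h (_ : h ≠ g) => A.grading h) (d m) h2 le_rfl) (hx m)
  have hq2 : Finsupp.linearCombination 𝕂 x q ∈ A.grading g := by
    rw [← eq_sub_iff_add_eq'] at hsum
    exact hsum ▸ Submodule.sub_mem _ hu hp
  have h0 := Submodule.disjoint_def.1 (A.isInternal.submodule_iSupIndep g) _ hq2 hq'
  have hq0 : q = 0 := x.linearIndependent (by rw [h0, map_zero])
  exact hi (by rw [← Finsupp.filter_apply_pos (fun m => ¬ d m = g) (x.repr u) hne, ← hq, hq0]; rfl)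

theorem mem_span_of_mem_grading (hx : ∀ i, x i ∈ A.grading (d i)) {g : G} {u : L}
    (hu : u ∈ A.grading g) : u ∈ Submodule.span 𝕂 (x '' {m | d m = g}) :=
  x.mem_span_image.2 fun _ hm => degree_eq_of_repr_ne_zero A hx hu (Finsupp.mem_support_iff.1 hm)

/-- The product in the tensor algebra of the basis vectors indexed by the letters of `l`. -/
noncomputable def word (x : Module.Basis I 𝕂 L) (l : List I) : TensorAlgebra 𝕂 L :=
  (l.map fun i => TensorAlgebra.ι 𝕂 (x i)).prod

@[simp] theorem word_nil (x : Module.Basis I 𝕂 L) : word x [] = 1 := rfl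

@[simp] theorem word_cons (x : Module.Basis I 𝕂 L) (i : I) (l : List I) :
    word x (i :: l) = TensorAlgebra.ι 𝕂 (x i) * word x l := by simp [word]

@[simp] theorem word_append (x : Module.Basis I 𝕂 L) (l m : List I) :
    word x (l ++ m) = word x l * word x m := by simp [word]

/-- The words form a basis of the tensor algebra. -/
noncomputable def wordBasis (x : Module.Basis I 𝕂 L) :
    Module.Basis (List I) 𝕂 (TensorAlgebra 𝕂 L) :=
  x.tensorAlgebra.reindex FreeMonoid.toList

theorem wordBasis_apply (x : Module.Basis I 𝕂 L) (l : List I) :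
    wordBasis x l = word x l := by
  have : FreeAlgebra.basisFreeMonoid 𝕂 I (FreeMonoid.ofList l)
      = (l.map (FreeAlgebra.ι 𝕂)).prod := by
    simp [FreeAlgebra.basisFreeMonoid, FreeAlgebra.equivMonoidAlgebraFreeMonoid,
      FreeMonoid.lift_apply]
  simp only [wordBasis, Module.Basis.reindex_apply, Module.Basis.tensorAlgebra,
    Module.Basis.map_apply, word]
  erw [this]
  simp [map_list_prod, Function.comp_def]

/-! ### The relators -/

/-- The defining relator of `U_ω(L)` for `u` and `v`, of degrees `g` and `h`. The degrees are
arguments so that the expression is bilinear in `u` and `v`. -/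
noncomputable def relator (A : ColorLieAlgebra ε L) (ω : L →ₗ[𝕂] L →ₗ[𝕂] 𝕂) (g h : G) (u v : L) :
    TensorAlgebra 𝕂 L :=
  TensorAlgebra.ι 𝕂 u * TensorAlgebra.ι 𝕂 v
    - (ε g h : 𝕂) • (TensorAlgebra.ι 𝕂 v * TensorAlgebra.ι 𝕂 u)
    - TensorAlgebra.ι 𝕂 (A.bracket u v) - algebraMap 𝕂 (TensorAlgebra 𝕂 L) (ω u v)

theorem relator_add_left (g h : G) (u u' v : L) :
    relator A ω g h (u + u') v = relator A ω g h u v + relator A ω g h u' v := by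
  simp only [relator, map_add, LinearMap.add_apply, add_mul, mul_add]
  module

theorem relator_add_right (g h : G) (u v v' : L) :
    relator A ω g h u (v + v') = relator A ω g h u v + relator A ω g h u v' := by
  simp only [relator, map_add, add_mul, mul_add]
  module

theorem relator_smul_left (g h : G) (c : 𝕂) (u v : L) :
    relator A ω g h (c • u) v = c • relator A ω g h u v := by
  simp only [relator, map_smul, LinearMap.smul_apply, smul_mul_assoc, mul_smul_comm,
    Algebra.algebraMap_eq_smul_one]
  module

theorem relator_smul_right (g h : G) (c : 𝕂) (u v : L) :
    relator A ω g h u (c • v) = c • relator A ω g h u v := by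
  simp only [relator, map_smul, smul_mul_assoc, mul_smul_comm,
    Algebra.algebraMap_eq_smul_one]
  module

theorem relator_zero_left (g h : G) (v : L) : relator A ω g h 0 v = 0 := by
  simp [relator]

theorem relator_zero_right (g h : G) (u : L) : relator A ω g h u 0 = 0 := by
  simp [relator]

theorem relator_swap (hε : IsAntisymmBicharacter ε) (hω : IsGradedTwoCocycle A ω) {g h : G}
    {u v : L} (hu : u ∈ A.grading g) (hv : v ∈ A.grading h) :
    relator A ω g h u v = -(ε g h : 𝕂) • relator A ω h g v u := by
  have e := hε.coe_mul_coe_swap g h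
  simp only [relator, A.bracket_skew g h u v hu hv, hω.skew g h u v hu hv,
    Algebra.algebraMap_eq_smul_one, map_neg, map_smul]
  linear_combination (norm := module) -(e • (TensorAlgebra.ι 𝕂 u * TensorAlgebra.ι 𝕂 v))

/-- In even degree the relator of `u` with itself vanishes already in the tensor algebra, since it
equals its own negative. -/
theorem relator_self_eq_zero [CharZero 𝕂] (hε : IsAntisymmBicharacter ε)
    (hω : IsGradedTwoCocycle A ω) {g : G} (hg : ε g g = 1) {u : L} (hu : u ∈ A.grading g) :
    relator A ω g g u u = 0 := by
  have h := relator_swap hε hω hu hu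
  rw [hg, Units.val_one] at h
  have h2 : (2 : 𝕂) • relator A ω g g u u = 0 := by
    linear_combination (norm := module) h
  exact (smul_eq_zero.1 h2).resolve_left two_ne_zero

/-- The Jacobi identity in derivation form. -/
theorem bracket_bracket (hε : IsAntisymmBicharacter ε) (A : ColorLieAlgebra ε L) {g h k : G}
    {u v w : L} (hu : u ∈ A.grading g) (hv : v ∈ A.grading h) (hw : w ∈ A.grading k) :
    A.bracket u (A.bracket v w)
      = (ε g h : 𝕂) • A.bracket v (A.bracket u w) + A.bracket (A.bracket u v) w := by
  have J := A.jacobi g h k u v w hu hv hw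
  rw [A.bracket_skew k g w u hw hu,
    A.bracket_skew k (g * h) w _ hw (A.bracket_mem g h u v hu hv)] at J
  have e := hε.coe_mul_coe_swap g k
  have e₂ : (ε g k * ε k g * (ε h k * ε k h) : 𝕂) = 1 := by
    rw [e, hε.coe_mul_coe_swap, one_mul]
  rw [hε.coe_map_mul_right] at J
  simp only [map_neg, map_smul] at J
  linear_combination (norm := module) (ε g k : 𝕂) • J
    - e • A.bracket u (A.bracket v w) + ((ε g h : 𝕂) • e) • A.bracket v (A.bracket u w)
    + e₂ • A.bracket (A.bracket u v) w

/-- The cocycle identity in derivation form. -/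
theorem cocycle_bracket (hε : IsAntisymmBicharacter ε) (hω : IsGradedTwoCocycle A ω) {g h k : G}
    {u v w : L} (hu : u ∈ A.grading g) (hv : v ∈ A.grading h) (hw : w ∈ A.grading k) :
    ω u (A.bracket v w) = (ε g h : 𝕂) * ω v (A.bracket u w) + ω (A.bracket u v) w := by
  have J := hω.cocycle g h k u v w hu hv hw
  rw [A.bracket_skew k g w u hw hu,
    hω.skew k (g * h) w _ hw (A.bracket_mem g h u v hu hv)] at J
  have e := hε.coe_mul_coe_swap g k
  have e₂ : (ε g k * ε k g * (ε h k * ε k h) : 𝕂) = 1 := by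
    rw [e, hε.coe_mul_coe_swap, one_mul]
  rw [hε.coe_map_mul_right] at J
  simp only [map_neg, map_smul, smul_eq_mul] at J
  linear_combination (ε g k : 𝕂) * J
    - e * ω u (A.bracket v w) + (ε g h : 𝕂) * e * ω v (A.bracket u w)
    + e₂ * ω (A.bracket u v) w

/-- As `ω` has degree zero, `ω u v ≠ 0` forces `ε(|u||v|, k) = 1` for all `k`. -/
theorem bichar_mul_cocycle (hε : IsAntisymmBicharacter ε)
    (hω : IsGradedTwoCocycle A ω) {g h : G} {u v : L} (hu : u ∈ A.grading g)
    (hv : v ∈ A.grading h) (k : G) : (ε g k * ε h k : 𝕂) * ω u v = ω u v := by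
  by_cases hgh : g * h = 1
  · have h1 : ε 1 k = 1 := by simpa using hε.map_mul_left 1 1 k
    rw [← hε.coe_map_mul_left, hgh, h1, Units.val_one, one_mul]
  · rw [hω.degree_zero g h u v hu hv hgh, mul_zero]

/-- The six relators on pairs of three letters, each multiplied by the remaining letter: their
alternating sum cancels in tensor degree three, and the rest consists of relators of a letter and a
bracket. -/
theorem relator_hexagon (hε : IsAntisymmBicharacter ε) (hω : IsGradedTwoCocycle A ω) {g h k : G}
    {u v w : L} (hu : u ∈ A.grading g) (hv : v ∈ A.grading h) (hw : w ∈ A.grading k) :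
    relator A ω g h u v * TensorAlgebra.ι 𝕂 w
      + (ε g h : 𝕂) • (TensorAlgebra.ι 𝕂 v * relator A ω g k u w)
      + (ε g h * ε g k : 𝕂) • (relator A ω h k v w * TensorAlgebra.ι 𝕂 u)
      - TensorAlgebra.ι 𝕂 u * relator A ω h k v w
      - (ε h k : 𝕂) • (relator A ω g k u w * TensorAlgebra.ι 𝕂 v)
      - (ε g k * ε h k : 𝕂) • (TensorAlgebra.ι 𝕂 w * relator A ω g h u v)
    = relator A ω g (h * k) u (A.bracket v w)
      - (ε g h : 𝕂) • relator A ω h (g * k) v (A.bracket u w)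
      - relator A ω (g * h) k (A.bracket u v) w := by
  -- By `c₁`, `c₂'` and `c₃'` the terms with a value of `ω` times a single letter cancel.
  have c₁ := bichar_mul_cocycle hε hω hu hv k
  have c₂ := bichar_mul_cocycle hε hω hu hw h
  have c₃ := bichar_mul_cocycle hε hω hv hw g
  have e := hε.coe_mul_coe_swap g h
  have e' := hε.coe_mul_coe_swap g k
  have e'' := hε.coe_mul_coe_swap h k
  have c₂' : ((ε h k : 𝕂) - ε g h) * ω u w = 0 := by
    linear_combination (-(ε h k : 𝕂)) * c₂ + ε g h * ω u w * e''
  have c₃' : ((ε g h : 𝕂) * ε g k - 1) * ω v w = 0 := by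
    linear_combination (-(ε g h : 𝕂) * ε g k) * c₃
      + ((ε k g * ε g k : 𝕂) * e + e') * ω v w
  simp only [relator, hε.coe_map_mul_left, hε.coe_map_mul_right, mul_sub, sub_mul,
    mul_smul_comm, smul_mul_assoc, Algebra.algebraMap_eq_smul_one, mul_one, one_mul, mul_assoc,
    bracket_bracket hε A hu hv hw, cocycle_bracket hε hω hu hv hw, map_add, map_smul]
  linear_combination (norm := module) c₁ • TensorAlgebra.ι 𝕂 w + c₂' • TensorAlgebra.ι 𝕂 v
    - c₃' • TensorAlgebra.ι 𝕂 u
    - ((ε h k : 𝕂) • e) • (TensorAlgebra.ι 𝕂 (A.bracket u w) * TensorAlgebra.ι 𝕂 v)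

/-- The relator of the letters `i, j`, placed between the words `a` and `b`. -/
noncomputable def wordRelator (A : ColorLieAlgebra ε L) (ω : L →ₗ[𝕂] L →ₗ[𝕂] 𝕂)
    (x : Module.Basis I 𝕂 L) (d : I → G) (a : List I) (i j : I) (b : List I) :
    TensorAlgebra 𝕂 L :=
  word x a * relator A ω (d i) (d j) (x i) (x j) * word x b

theorem wordRelator_eq (a : List I) (i j : I) (b : List I) :
    wordRelator A ω x d a i j b = word x (a ++ i :: j :: b)
      - (ε (d i) (d j) : 𝕂) • word x (a ++ j :: i :: b)
      - word x a * TensorAlgebra.ι 𝕂 (A.bracket (x i) (x j)) * word x b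
      - ω (x i) (x j) • word x (a ++ b) := by
  simp only [wordRelator, relator, word_append, word_cons, mul_sub, sub_mul, mul_assoc,
    Algebra.algebraMap_eq_smul_one, smul_mul_assoc, mul_smul_comm, one_mul]

theorem mkAlgHom_relator {g h : G} {u v : L} (hu : u ∈ A.grading g) (hv : v ∈ A.grading h) :
    RingQuot.mkAlgHom 𝕂 (GenEnvRel A ω) (relator A ω g h u v) = 0 := by
  rw [← map_zero (RingQuot.mkAlgHom 𝕂 (GenEnvRel A ω))]
  exact RingQuot.mkAlgHom_rel 𝕂 (.rel g h u v hu hv)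

theorem mkAlgHom_word (l : List I) : RingQuot.mkAlgHom 𝕂 (GenEnvRel A ω) (word x l)
    = (l.map fun i => GenEnv.ι A ω (x i)).prod := by
  simp [word, map_list_prod, GenEnv.ι, Function.comp_def]

/-! ### Reduction of words with an inversion -/

variable [LinearOrder I]

/-- The span of the words that precede `w` in the shortlex order. -/
noncomputable def below (x : Module.Basis I 𝕂 L) (w : List I) :
    Submodule 𝕂 (TensorAlgebra 𝕂 L) :=
  Submodule.span 𝕂 (wordBasis x '' {v | List.Shortlex (· < ·) v w})

theorem word_mem_below {v w : List I} (h : List.Shortlex (· < ·) v w) : word x v ∈ below x w :=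
  Submodule.subset_span ⟨v, h, wordBasis_apply x v⟩

theorem word_mul_ι_mul_word_mem_below {a b w : List I} (h : a.length + b.length + 1 < w.length)
    (u : L) : word x a * TensorAlgebra.ι 𝕂 u * word x b ∈ below x w := by
  have hu := x.mem_span u
  induction hu using Submodule.span_induction with
  | mem u hu =>
    obtain ⟨i, rfl⟩ := hu
    have : List.Shortlex (· < ·) (a ++ i :: b) w := .of_length_lt (by simpa [← add_assoc] using h)
    simpa [mul_assoc] using word_mem_below (x := x) this
  | zero => simp
  | add u v _ _ hu hv => simpa [mul_add, add_mul] using Submodule.add_mem _ hu hv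
  | smul c u _ hu => simpa using Submodule.smul_mem _ c hu

/-- A suitable multiple of the relator rewrites a word with an inversion into smaller words. -/
theorem exists_reduction [CharZero 𝕂] (hε : IsAntisymmBicharacter ε) (A : ColorLieAlgebra ε L)
    (ω : L →ₗ[𝕂] L →ₗ[𝕂] 𝕂) (x : Module.Basis I 𝕂 L) {i j : I} (hij : IsInversion ε d i j)
    (a b : List I) :
    ∃ c : 𝕂, c ≠ 0 ∧
      word x (a ++ i :: j :: b) - c • wordRelator A ω x d a i j b
        ∈ below x (a ++ i :: j :: b) := by
  have h₁ := word_mul_ι_mul_word_mem_below (x := x) (a := a) (b := b) (w := a ++ i :: j :: b)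
    (by simp; lia) (A.bracket (x i) (x j))
  have h₂ : word x (a ++ b) ∈ below x (a ++ i :: j :: b) :=
    word_mem_below (.of_length_lt (by simp))
  have h₃ := add_mem h₁ (Submodule.smul_mem _ (ω (x i) (x j)) h₂)
  rcases hij with hij | ⟨rfl, hi⟩
  · refine ⟨1, one_ne_zero, ?_⟩
    convert add_mem (Submodule.smul_mem _ (ε (d i) (d j) : 𝕂)
      (word_mem_below (x := x) (shortlex_append_cons (s := i :: b) (t := j :: b) hij a rfl))) h₃
      using 1
    rw [wordRelator_eq]
    module
  -- Here `ε (d i) (d i) = -1`, so the relator has leading term `2 • word x (a ++ i :: i :: b)`.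
  · refine ⟨1 / 2, by norm_num, ?_⟩
    convert Submodule.smul_mem _ (1 / 2 : 𝕂) h₃ using 1
    rw [wordRelator_eq, hε.self_eq_neg_one hi]
    module

/-! ### Independence of the chosen inversion -/

section
variable {S : Type*} [AddCommGroup S] [Module 𝕂 S] {σ : TensorAlgebra 𝕂 L →ₗ[𝕂] S} {w : List I}

/-- `σ` vanishes on the relators placed at inversions of words smaller than `w`: the induction
hypothesis of the diamond lemma. -/
def KillsBelow (A : ColorLieAlgebra ε L) (ω : L →ₗ[𝕂] L →ₗ[𝕂] 𝕂) (x : Module.Basis I 𝕂 L)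
    (d : I → G) (σ : TensorAlgebra 𝕂 L →ₗ[𝕂] S) (w : List I) : Prop :=
  ∀ a i j b, List.Shortlex (· < ·) (a ++ i :: j :: b) w → IsInversion ε d i j →
    σ (wordRelator A ω x d a i j b) = 0

variable [CharZero 𝕂]

/-- The pair `i, j` need not be an inversion, provided the words with `i, j` in either order both
precede `w`. -/
theorem KillsBelow.map_wordRelator (H : KillsBelow A ω x d σ w) (hε : IsAntisymmBicharacter ε)
    (hω : IsGradedTwoCocycle A ω) (hx : ∀ i, x i ∈ A.grading (d i)) {a b : List I} {i j : I}
    (h₁ : List.Shortlex (· < ·) (a ++ i :: j :: b) w)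
    (h₂ : List.Shortlex (· < ·) (a ++ j :: i :: b) w) :
    σ (wordRelator A ω x d a i j b) = 0 := by
  rcases lt_trichotomy j i with h | rfl | h
  · exact H _ _ _ _ h₁ (.inl h)
  · by_cases hj : ε (d j) (d j) = 1
    · simp [wordRelator, relator_self_eq_zero hε hω hj (hx j)]
    · exact H _ _ _ _ h₁ (.inr ⟨rfl, hj⟩)
  · have := H _ _ _ _ h₂ (.inl h)
    rw [wordRelator] at this ⊢
    rw [relator_swap hε hω (hx i) (hx j), mul_smul_comm, smul_mul_assoc, map_smul, this,
      smul_zero]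

/-- Relators of arbitrary homogeneous elements, placed where the total length is less than that of
`w`. -/
theorem KillsBelow.map_relator (H : KillsBelow A ω x d σ w) (hε : IsAntisymmBicharacter ε)
    (hω : IsGradedTwoCocycle A ω) (hx : ∀ i, x i ∈ A.grading (d i)) {a b : List I}
    (hw : a.length + b.length + 2 < w.length) {g h : G} {u v : L}
    (hu : u ∈ A.grading g) (hv : v ∈ A.grading h) :
    σ (word x a * relator A ω g h u v * word x b) = 0 := by
  replace hu := mem_span_of_mem_grading hx hu
  replace hv := mem_span_of_mem_grading hx hv
  induction hu using Submodule.span_induction with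
  | zero => rw [relator_zero_left, mul_zero, zero_mul, map_zero]
  | add u u' _ _ ih ih' => rw [relator_add_left, mul_add, add_mul, map_add, ih, ih', add_zero]
  | smul c u _ ih =>
    rw [relator_smul_left, mul_smul_comm, smul_mul_assoc, map_smul, ih, smul_zero]
  | mem u hu =>
    obtain ⟨i, rfl, rfl⟩ := hu
    induction hv using Submodule.span_induction with
    | zero => rw [relator_zero_right, mul_zero, zero_mul, map_zero]
    | add u u' _ _ ih ih' => rw [relator_add_right, mul_add, add_mul, map_add, ih, ih', add_zero]
    | smul c u _ ih =>
      rw [relator_smul_right, mul_smul_comm, smul_mul_assoc, map_smul, ih, smul_zero]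
    | mem v hv =>
      obtain ⟨j, rfl, rfl⟩ := hv
      exact H.map_wordRelator hε hω hx (.of_length_lt (by simp; lia))
        (.of_length_lt (by simp; lia))

theorem KillsBelow.hexagon {a b : List I} {i j k : I}
    (H : KillsBelow A ω x d σ (a ++ i :: j :: k :: b)) (hε : IsAntisymmBicharacter ε)
    (hω : IsGradedTwoCocycle A ω) (hx : ∀ i, x i ∈ A.grading (d i)) :
    σ (wordRelator A ω x d a i j (k :: b))
      + (ε (d i) (d j) : 𝕂) • σ (wordRelator A ω x d (a ++ [j]) i k b)
      + (ε (d i) (d j) * ε (d i) (d k) : 𝕂) • σ (wordRelator A ω x d a j k (i :: b))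
      - σ (wordRelator A ω x d (a ++ [i]) j k b)
      - (ε (d j) (d k) : 𝕂) • σ (wordRelator A ω x d a i k (j :: b))
      - (ε (d i) (d k) * ε (d j) (d k) : 𝕂) • σ (wordRelator A ω x d (a ++ [k]) i j b) = 0 := by
  have hl : a.length + b.length + 2 < (a ++ i :: j :: k :: b).length := by simp; lia
  have h := congrArg (fun t => σ (word x a * t * word x b))
    (relator_hexagon hε hω (hx i) (hx j) (hx k))
  simp only [mul_sub, sub_mul, map_sub, mul_smul_comm, smul_mul_assoc, map_smul,
    H.map_relator hε hω hx hl (hx i) (A.bracket_mem _ _ _ _ (hx j) (hx k)),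
    H.map_relator hε hω hx hl (hx j) (A.bracket_mem _ _ _ _ (hx i) (hx k)),
    H.map_relator hε hω hx hl (A.bracket_mem _ _ _ _ (hx i) (hx j)) (hx k),
    smul_zero, sub_zero, mul_add, add_mul, map_add] at h
  simpa only [wordRelator, word_append, word_cons, word_nil, mul_one, mul_assoc] using h

/-- Two inversions that share a letter: both relators are killed as soon as one is. -/
theorem KillsBelow.overlap {a b : List I} {i j k : I}
    (H : KillsBelow A ω x d σ (a ++ i :: j :: k :: b)) (hε : IsAntisymmBicharacter ε)
    (hω : IsGradedTwoCocycle A ω) (hx : ∀ i, x i ∈ A.grading (d i))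
    (hij : IsInversion ε d i j) (hjk : IsInversion ε d j k) :
    σ (wordRelator A ω x d a i j (k :: b)) = 0 ↔
      σ (wordRelator A ω x d (a ++ [i]) j k b) = 0 := by
  have h := H.hexagon hε hω hx
  -- Of the six terms of `h`, those at smaller words vanish; the others repeat the two in question.
  rcases hij with hij | ⟨rfl, hi⟩ <;> rcases hjk with hjk | ⟨rfl, hj⟩
  · have h₂ := H.map_wordRelator hε hω hx (a := a ++ [j]) (i := i) (j := k) (b := b)
      (by simpa using shortlex_append_cons hij a (by simp))
      (by simpa using shortlex_append_cons hij a (by simp))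
    have h₃ := H.map_wordRelator hε hω hx (a := a) (i := j) (j := k) (b := i :: b)
      (shortlex_append_cons hij a (by simp)) (shortlex_append_cons (hjk.trans hij) a (by simp))
    have h₅ := H.map_wordRelator hε hω hx (a := a) (i := i) (j := k) (b := j :: b)
      (by simpa using shortlex_append_cons hjk (a ++ [i]) (by simp))
      (shortlex_append_cons (hjk.trans hij) a (by simp))
    have h₆ := H.map_wordRelator hε hω hx (a := a ++ [k]) (i := i) (j := j) (b := b)
      (by simpa using shortlex_append_cons (hjk.trans hij) a (by simp))
      (by simpa using shortlex_append_cons (hjk.trans hij) a (by simp))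
    rw [h₂, h₃, h₅, h₆, smul_zero, smul_zero, smul_zero, smul_zero, add_zero, add_zero, sub_zero,
      sub_zero, sub_eq_zero] at h
    rw [h]
  · have h₂ := H.map_wordRelator hε hω hx (a := a ++ [j]) (i := i) (j := j) (b := b)
      (by simpa using shortlex_append_cons hij a (by simp))
      (by simpa using shortlex_append_cons hij a (by simp))
    have h₃ := H.map_wordRelator hε hω hx (a := a) (i := j) (j := j) (b := i :: b)
      (shortlex_append_cons hij a (by simp)) (shortlex_append_cons hij a (by simp))
    rw [h₂, h₃, hε.self_eq_neg_one hj] at h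
    have h' : σ (wordRelator A ω x d (a ++ [i]) j j b)
        = (2 : 𝕂) • σ (wordRelator A ω x d a i j (j :: b)) := by
      linear_combination (norm := module) -h
    rw [h', smul_eq_zero_iff_right two_ne_zero]
  · have h₃ := H.map_wordRelator hε hω hx (a := a) (i := i) (j := k) (b := i :: b)
      (by simpa using shortlex_append_cons hjk (a ++ [i]) (by simp))
      (shortlex_append_cons hjk a (by simp))
    have h₆ := H.map_wordRelator hε hω hx (a := a ++ [k]) (i := i) (j := i) (b := b)
      (by simpa using shortlex_append_cons hjk a (by simp))
      (by simpa using shortlex_append_cons hjk a (by simp))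
    rw [h₃, h₆, hε.self_eq_neg_one hi] at h
    have h' : σ (wordRelator A ω x d a i i (k :: b))
        = (2 : 𝕂) • σ (wordRelator A ω x d (a ++ [i]) i k b) := by
      linear_combination (norm := module) h
    rw [h', smul_eq_zero_iff_right two_ne_zero]
  · rw [hε.self_eq_neg_one hi] at h
    have h' : (3 : 𝕂) • (σ (wordRelator A ω x d a i i (i :: b))
        - σ (wordRelator A ω x d (a ++ [i]) i i b)) = 0 := by
      linear_combination (norm := module) h
    rw [sub_eq_zero.1 ((smul_eq_zero.1 h').resolve_left three_ne_zero)]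

/-- With relators at both of two disjoint inversions, expanding the right one leaves a nonzero
multiple of the left relator in the word itself (twice it, when `k = l`), up to smaller words. -/
theorem KillsBelow.map_relator_mul_relator_left {a b c : List I} {i j k l : I}
    (H : KillsBelow A ω x d σ (a ++ i :: j :: (b ++ k :: l :: c))) (hε : IsAntisymmBicharacter ε)
    (hij : IsInversion ε d i j) (hkl : IsInversion ε d k l) :
    ∃ r : 𝕂, r ≠ 0 ∧ σ (word x a * relator A ω (d i) (d j) (x i) (x j) * word x b *
      relator A ω (d k) (d l) (x k) (x l) * word x c)
        = r • σ (wordRelator A ω x d a i j (b ++ k :: l :: c)) := by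
  have key : ∀ m : List I, m.length < b.length + c.length + 2 →
      σ (wordRelator A ω x d a i j m) = 0 := fun m hm =>
    H _ _ _ _ (.of_length_lt (by simp; lia)) hij
  have hb : ∀ u, σ (word x a * relator A ω (d i) (d j) (x i) (x j) *
      (word x b * TensorAlgebra.ι 𝕂 u * word x c)) = 0 := by
    intro u
    induction x.mem_span u using Submodule.span_induction with
    | mem u hu =>
      obtain ⟨m, rfl⟩ := hu
      simpa [wordRelator, mul_assoc] using key (b ++ m :: c) (by simp; lia)
    | zero => simp
    | add u v _ _ hu hv => rw [map_add, mul_add, add_mul, mul_add, map_add, hu, hv, add_zero]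
    | smul r u _ hu =>
      rw [map_smul, mul_smul_comm, smul_mul_assoc, mul_smul_comm, map_smul, hu, smul_zero]
  have h₀ := key (b ++ c) (by simp)
  have h : σ (word x a * relator A ω (d i) (d j) (x i) (x j) * word x b *
      relator A ω (d k) (d l) (x k) (x l) * word x c)
      = σ (wordRelator A ω x d a i j (b ++ k :: l :: c))
        - (ε (d k) (d l) : 𝕂) • σ (wordRelator A ω x d a i j (b ++ l :: k :: c)) := by
    have e : word x a * relator A ω (d i) (d j) (x i) (x j) * word x b *
      relator A ω (d k) (d l) (x k) (x l) * word x c =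
      word x a * relator A ω (d i) (d j) (x i) (x j) * wordRelator A ω x d b k l c := by
      simp only [wordRelator, mul_assoc]
    rw [e, wordRelator_eq, mul_sub, mul_sub, mul_sub, mul_smul_comm, mul_smul_comm, map_sub,
      map_sub, map_sub, map_smul, map_smul, hb]
    change _ - _ • σ (wordRelator A ω x d a i j _) - 0 - _ • σ (wordRelator A ω x d a i j _) = _
    rw [h₀, smul_zero, sub_zero, sub_zero]
    rfl
  rcases hkl with hkl | ⟨rfl, hk⟩
  · refine ⟨1, one_ne_zero, ?_⟩
    have h' := H a i j (b ++ l :: k :: c)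
      (by simpa using shortlex_append_cons (s := k :: c) (t := l :: c) hkl (a ++ i :: j :: b) rfl)
      hij
    rw [h, h', smul_zero, sub_zero, one_smul]
  · refine ⟨2, two_ne_zero, ?_⟩
    rw [h, hε.self_eq_neg_one hk]
    module

/-- With relators at both of two disjoint inversions, expanding the left one leaves a nonzero
multiple of the right relator in the word itself (twice it, when `i = j`), up to smaller words. -/
theorem KillsBelow.map_relator_mul_relator_right {a b c : List I} {i j k l : I}
    (H : KillsBelow A ω x d σ (a ++ i :: j :: (b ++ k :: l :: c))) (hε : IsAntisymmBicharacter ε)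
    (hij : IsInversion ε d i j) (hkl : IsInversion ε d k l) :
    ∃ r : 𝕂, r ≠ 0 ∧ σ (word x a * relator A ω (d i) (d j) (x i) (x j) * word x b *
      relator A ω (d k) (d l) (x k) (x l) * word x c)
        = r • σ (wordRelator A ω x d (a ++ i :: j :: b) k l c) := by
  have key : ∀ m : List I, m.length < a.length + b.length + 2 →
      σ (wordRelator A ω x d m k l c) = 0 := fun m hm =>
    H _ _ _ _ (.of_length_lt (by simp; lia)) hkl
  have hb : ∀ u, σ (word x a * TensorAlgebra.ι 𝕂 u * word x b *
      relator A ω (d k) (d l) (x k) (x l) * word x c) = 0 := by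
    intro u
    induction x.mem_span u using Submodule.span_induction with
    | mem u hu =>
      obtain ⟨m, rfl⟩ := hu
      simpa [wordRelator, mul_assoc] using key (a ++ m :: b) (by simp; lia)
    | zero => simp
    | add u v _ _ hu hv => simp only [map_add, mul_add, add_mul, hu, hv, add_zero]
    | smul r u _ hu =>
      simp only [map_smul, mul_smul_comm, smul_mul_assoc, hu, smul_zero]
  have h₀ := key (a ++ b) (by simp)
  have h : σ (word x a * relator A ω (d i) (d j) (x i) (x j) * word x b *
      relator A ω (d k) (d l) (x k) (x l) * word x c)
      = σ (wordRelator A ω x d (a ++ i :: j :: b) k l c)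
        - (ε (d i) (d j) : 𝕂) • σ (wordRelator A ω x d (a ++ j :: i :: b) k l c) := by
    change σ (wordRelator A ω x d a i j b * _ * _) = _
    rw [wordRelator_eq, sub_mul, sub_mul, sub_mul, sub_mul, sub_mul, sub_mul, smul_mul_assoc,
      smul_mul_assoc, smul_mul_assoc, smul_mul_assoc, map_sub,
      map_sub, map_sub, map_smul, map_smul, hb]
    change _ - _ • σ (wordRelator A ω x d _ k l c) - 0 - _ • σ (wordRelator A ω x d _ k l c) = _
    rw [h₀, smul_zero, sub_zero, sub_zero]
    rfl
  rcases hij with hij | ⟨rfl, hi⟩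
  · refine ⟨1, one_ne_zero, ?_⟩
    have h' := H (a ++ j :: i :: b) k l c
      (by simpa using shortlex_append_cons hij a (by simp)) hkl
    rw [h, h', smul_zero, sub_zero, one_smul]
  · refine ⟨2, two_ne_zero, ?_⟩
    rw [h, hε.self_eq_neg_one hi]
    module

/-- Two inversions without a common letter: both relators are killed as soon as one is. -/
theorem KillsBelow.disjoint {a b c : List I} {i j k l : I}
    (H : KillsBelow A ω x d σ (a ++ i :: j :: (b ++ k :: l :: c))) (hε : IsAntisymmBicharacter ε)
    (hij : IsInversion ε d i j) (hkl : IsInversion ε d k l) :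
    σ (wordRelator A ω x d a i j (b ++ k :: l :: c)) = 0 ↔
      σ (wordRelator A ω x d (a ++ i :: j :: b) k l c) = 0 := by
  obtain ⟨r, hr, h⟩ := H.map_relator_mul_relator_left hε hij hkl
  obtain ⟨s, hs, h'⟩ := H.map_relator_mul_relator_right hε hij hkl
  rw [← smul_eq_zero_iff_right hr, ← h, h', smul_eq_zero_iff_right hs]

/-- Any two inversions of `w`: both relators are killed as soon as one is. -/
theorem KillsBelow.iff_of_eq {w a a' b b' : List I} {i j i' j' : I}
    (H : KillsBelow A ω x d σ w) (hε : IsAntisymmBicharacter ε)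
    (hω : IsGradedTwoCocycle A ω) (hx : ∀ i, x i ∈ A.grading (d i))
    (hw : w = a ++ i :: j :: b) (hw' : w = a' ++ i' :: j' :: b')
    (hij : IsInversion ε d i j) (hij' : IsInversion ε d i' j') :
    σ (wordRelator A ω x d a i j b) = 0 ↔ σ (wordRelator A ω x d a' i' j' b') = 0 := by
  have main : ∀ {a a' b b' : List I} {i j i' j' : I}, w = a ++ i :: j :: b →
      w = a' ++ i' :: j' :: b' → IsInversion ε d i j → IsInversion ε d i' j' →
      (∃ c, a' = a ++ c) →
      (σ (wordRelator A ω x d a i j b) = 0 ↔ σ (wordRelator A ω x d a' i' j' b') = 0) := by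
    rintro a _ b b' i j i' j' rfl hw' hij hij' ⟨c, rfl⟩
    rw [List.append_assoc, List.append_cancel_left_eq] at hw'
    match c, hw' with
    | [], hw' =>
      simp only [List.nil_append, List.cons.injEq] at hw'
      obtain ⟨rfl, rfl, rfl⟩ := hw'
      rw [List.append_nil]
    | [_], hw' =>
      simp only [List.cons_append, List.nil_append, List.cons.injEq] at hw'
      obtain ⟨rfl, rfl, rfl⟩ := hw'
      exact H.overlap hε hω hx hij hij'
    | _ :: _ :: c, hw' =>
      simp only [List.cons_append, List.cons.injEq] at hw'
      obtain ⟨rfl, rfl, rfl⟩ := hw'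
      exact H.disjoint hε hij hij'
  rcases List.append_eq_append_iff.1 (hw.symm.trans hw') with ⟨c, hc, -⟩ | ⟨c, hc, -⟩
  · exact main hw hw' hij hij' ⟨c, hc⟩
  · exact (main hw' hw hij' hij ⟨c, hc⟩).symm
end

/-! ### The normal form and the quotient -/

/-- The normal form map: it fixes the ordered words and kills the defining ideal of `U_ω(L)`. -/
theorem exists_normalForm [WellFoundedLT I] [CharZero 𝕂] (hε : IsAntisymmBicharacter ε)
    (hω : IsGradedTwoCocycle A ω) (hx : ∀ i, x i ∈ A.grading (d i)) :
    ∃ σ : TensorAlgebra 𝕂 L →ₗ[𝕂] List I →₀ 𝕂,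
      (∀ l, IsOrderedSeq ε d l → σ (word x l) = Finsupp.single l 1) ∧
      ∀ g h u v, u ∈ A.grading g → v ∈ A.grading h →
        ∀ p q, σ (p * relator A ω g h u v * q) = 0 := by
  classical
  have hred : ∀ w : List I, ∃ τ ∈ below x w, (IsOrderedSeq ε d w → τ = 0) ∧
      (¬ IsOrderedSeq ε d w → ∃ a i j b, w = a ++ i :: j :: b ∧ IsInversion ε d i j ∧
        ∃ c : 𝕂, c ≠ 0 ∧ word x w - τ = c • wordRelator A ω x d a i j b) := by
    intro w
    by_cases hw : IsOrderedSeq ε d w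
    · exact ⟨0, zero_mem _, fun _ => rfl, fun h => absurd hw h⟩
    · have := hw
      rw [isOrderedSeq_iff] at this
      push Not at this
      obtain ⟨a, i, j, b, rfl, hij⟩ := this
      obtain ⟨c, hc, h⟩ := exists_reduction hε A ω x hij a b
      exact ⟨_, h, fun h => absurd h hw, fun _ => ⟨a, i, j, b, rfl, hij, c, hc, by abel⟩⟩
  -- `τ w` is `w` rewritten once at a chosen inversion.
  choose τ hτ hτ₀ hτ₁ using hred
  obtain ⟨σ, hσ⟩ := exists_linearMap_of_reduction (wordBasis x)
    (List.Shortlex.wf (wellFounded_lt (α := I)))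
    (fun w => if IsOrderedSeq ε d w then Finsupp.single w (1 : 𝕂) else 0) τ hτ
  simp only [wordBasis_apply] at hσ
  have H : ∀ w, KillsBelow A ω x d σ w := by
    intro w
    induction w using (List.Shortlex.wf (wellFounded_lt (α := I))).induction with
    | _ w ih =>
    intro a i j b hw hij
    have hno : ¬ IsOrderedSeq ε d (a ++ i :: j :: b) := fun h =>
      isOrderedSeq_iff.1 h a i j b rfl hij
    obtain ⟨a', i', j', b', e, hij', c, hc, h⟩ := hτ₁ _ hno
    refine ((ih _ hw).iff_of_eq hε hω hx rfl e hij hij').2 ?_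
    rw [← smul_eq_zero_iff_right hc, ← map_smul, ← h, map_sub, hσ, if_neg hno, zero_add, sub_self]
  refine ⟨σ, fun l hl => by rw [hσ, if_pos hl, hτ₀ l hl, map_zero, add_zero], ?_⟩
  intro g h u v hu hv p q
  induction (wordBasis x).mem_span p using Submodule.span_induction with
  | zero => simp
  | add p p' _ _ ih ih' => rw [add_mul, add_mul, map_add, ih, ih', add_zero]
  | smul c p _ ih => rw [smul_mul_assoc, smul_mul_assoc, map_smul, ih, smul_zero]
  | mem p hp =>
    obtain ⟨a, rfl⟩ := hp
    induction (wordBasis x).mem_span q using Submodule.span_induction with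
    | zero => simp
    | add p p' _ _ ih ih' => rw [mul_add, map_add, ih, ih', add_zero]
    | smul c p _ ih => rw [mul_smul_comm, map_smul, ih, smul_zero]
    | mem q hq =>
      obtain ⟨b, rfl⟩ := hq
      rw [wordBasis_apply, wordBasis_apply]
      rcases isEmpty_or_nonempty I with hI | ⟨⟨i⟩⟩
      · have : u = 0 := x.ext_elem fun i => isEmptyElim i
        rw [this, relator_zero_left, mul_zero, zero_mul, map_zero]
      -- Any word of length at least `a.length + b.length + 3` bounds the relator.
      · exact (H (List.replicate (a.length + b.length + 3) i)).map_relator hε hω hx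
          (by simp) hu hv

theorem mkAlgHom_word_mem_span [WellFoundedLT I] [CharZero 𝕂] (hε : IsAntisymmBicharacter ε)
    (hx : ∀ i, x i ∈ A.grading (d i)) (w : List I) :
    RingQuot.mkAlgHom 𝕂 (GenEnvRel A ω) (word x w) ∈ Submodule.span 𝕂
      (Set.range fun l : {l : List I // IsOrderedSeq ε d l} =>
        RingQuot.mkAlgHom 𝕂 (GenEnvRel A ω) (word x l.1)) := by
  induction w using (List.Shortlex.wf (wellFounded_lt (α := I))).induction with
  | _ w ih =>
  by_cases hw : IsOrderedSeq ε d w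
  · exact Submodule.subset_span ⟨⟨w, hw⟩, rfl⟩
  · rw [isOrderedSeq_iff] at hw
    push Not at hw
    obtain ⟨a, i, j, b, rfl, hij⟩ := hw
    obtain ⟨c, -, h⟩ := exists_reduction hε A ω x hij a b
    have hle : below x (a ++ i :: j :: b) ≤ (Submodule.span 𝕂
      (Set.range fun l : {l : List I // IsOrderedSeq ε d l} =>
        RingQuot.mkAlgHom 𝕂 (GenEnvRel A ω) (word x l.1))).comap
          (RingQuot.mkAlgHom 𝕂 (GenEnvRel A ω)).toLinearMap := by
      rw [below, Submodule.span_le]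
      rintro _ ⟨v, hv, rfl⟩
      rw [wordBasis_apply]
      exact ih v hv
    have := hle h
    rwa [Submodule.mem_comap, AlgHom.toLinearMap_apply, map_sub, map_smul, wordRelator, map_mul,
      map_mul, mkAlgHom_relator (hx i) (hx j), mul_zero, zero_mul, smul_zero, sub_zero] at this

end ColorLie

theorem theorem2p1 {𝕂 : Type*} [Field 𝕂] [CharZero 𝕂]
    {G : Type*} [CommGroup G] [DecidableEq G]
    (ε : G → G → 𝕂ˣ) (hε : ColorLie.IsAntisymmBicharacter ε)
    {L : Type*} [AddCommGroup L] [Module 𝕂 L] (A : ColorLie.ColorLieAlgebra ε L)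
    (ω : L →ₗ[𝕂] L →ₗ[𝕂] 𝕂) (hω : ColorLie.IsGradedTwoCocycle A ω)
    {I : Type*} [LinearOrder I] [WellFoundedLT I]
    (x : Module.Basis I 𝕂 L) (d : I → G) (hx : ∀ i, x i ∈ A.grading (d i)) :
    (∃ b : Module.Basis {l : List I // ColorLie.IsOrderedSeq ε d l} 𝕂 (ColorLie.GenEnv A ω),
      ∀ l, b l = (l.1.map fun i => ColorLie.GenEnv.ι A ω (x i)).prod) ∧
    (∀ g h a b, a ∈ A.grading g → b ∈ A.grading h →
      ColorLie.GenEnv.ι A ω a * ColorLie.GenEnv.ι A ω b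
          - (ε g h : 𝕂) • (ColorLie.GenEnv.ι A ω b * ColorLie.GenEnv.ι A ω a)
        = ColorLie.GenEnv.ι A ω (A.bracket a b) + algebraMap 𝕂 (ColorLie.GenEnv A ω) (ω a b)) ∧
    Function.Injective (ColorLie.GenEnv.ι A ω) := by
  open ColorLie in
  obtain ⟨σ, hσ₁, hσ₂⟩ := exists_normalForm hε hω hx
  have hσ : ∀ s t, GenEnvRel A ω s t → ∀ p q, σ (p * s * q) = σ (p * t * q) := by
    rintro _ _ ⟨g, h, u, v, hu, hv⟩ p q
    rw [mul_zero, zero_mul, map_zero]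
    exact hσ₂ g h u v hu hv p q
  have hli : LinearIndependent 𝕂 fun l : {l : List I // IsOrderedSeq ε d l} =>
      RingQuot.mkAlgHom 𝕂 (GenEnvRel A ω) (word x l.1) := by
    refine linearIndependent_iff.2 fun c hc => ?_
    have h₁ : RingQuot.mkAlgHom 𝕂 (GenEnvRel A ω)
        (Finsupp.linearCombination 𝕂 (fun l : {l // IsOrderedSeq ε d l} => word x l.1) c)
        = RingQuot.mkAlgHom 𝕂 (GenEnvRel A ω) 0 := by
      rw [map_zero, ← hc, ← AlgHom.toLinearMap_apply, Finsupp.apply_linearCombination]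
      rfl
    have h₂ := map_eq_of_mkAlgHom_eq σ hσ h₁
    rw [map_zero, Finsupp.apply_linearCombination] at h₂
    have h₃ : (σ ∘ fun l : {l // IsOrderedSeq ε d l} => word x l.1)
        = fun l => Finsupp.single l.1 (1 : 𝕂) := funext fun l => hσ₁ l.1 l.2
    rw [h₃] at h₂
    exact linearIndependent_iff.1 ((Finsupp.basisSingleOne (R := 𝕂)
      (ι := List I)).linearIndependent.comp _ Subtype.val_injective) c (by
        simpa [Function.comp_def] using h₂)
  have hsp : ⊤ ≤ Submodule.span 𝕂 (Set.range fun l : {l : List I // IsOrderedSeq ε d l} =>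
      RingQuot.mkAlgHom 𝕂 (GenEnvRel A ω) (word x l.1)) := by
    rintro y -
    obtain ⟨t, rfl⟩ := RingQuot.mkAlgHom_surjective 𝕂 (GenEnvRel A ω) y
    induction (wordBasis x).mem_span t using Submodule.span_induction with
    | zero => simp
    | add s t _ _ hs ht => rw [map_add]; exact add_mem hs ht
    | smul c t _ ht => rw [map_smul]; exact Submodule.smul_mem _ c ht
    | mem t ht =>
      obtain ⟨w, rfl⟩ := ht
      rw [wordBasis_apply]
      exact mkAlgHom_word_mem_span hε hx w
  refine ⟨⟨Module.Basis.mk hli hsp, fun l => ?_⟩, fun g h a b ha hb => ?_, ?_⟩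
  · rw [Module.Basis.mk_apply, mkAlgHom_word]
  · have := mkAlgHom_relator (ω := ω) ha hb
    rw [relator, map_sub, map_sub, map_sub, map_smul, map_mul, map_mul, AlgHom.commutes,
      sub_sub, sub_eq_zero] at this
    exact this
  · have h := hli.comp (fun i : I => (⟨[i], List.isChain_singleton i⟩ :
      {l : List I // IsOrderedSeq ε d l})) (fun i j hij => by
        simpa using congrArg Subtype.val hij)
    have h' : LinearIndependent 𝕂 (GenEnv.ι A ω ∘ x) := by
      have e : GenEnv.ι A ω ∘ x = fun i : I =>
          RingQuot.mkAlgHom 𝕂 (GenEnvRel A ω) (word x [i]) :=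
        funext fun i => by rw [mkAlgHom_word]; simp
      rw [e]
      exact h
    exact LinearMap.injective_of_linearIndependent x.span_eq h'
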